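/- Let $n\ge 0$ and let $\mu_n$ be the standard Gaussian measure on $\mathbb{R}^n$, that is, $\mu_n(A)=(2\pi)^{-n/2}\int_A e^{-|x|^2/2}\,dx$, where $|\cdot|$ is the Euclidean norm. A centered ellipsoid in $\mathbb{R}^n$ is a set of the form $U\bigl(\{x\in\mathbb{R}^n:\sum_{i=1}^n x_i^2/r_i^2\le 1\}\bigr)$ with $r_1,\dots,r_n>0$ and $U$ an orthogonal transformation of $\mathbb{R}^n$. If $A$ and $B$ are any two centered ellipsoids in $\mathbb{R}^n$, then $$\mu_n(A\cap B)\ge \mu_n(A)\,\mu_n(B).$$ -/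

import Mathlib

/-- The ellipsoid in standard position with semi-axes `r i` along the usual unit basis of `ℝⁿ`:
`{x : ∑ i, x i ^ 2 / r i ^ 2 ≤ 1}`. Meant for `r i > 0`. -/
def standardEllipsoid {n : ℕ} (r : Fin n → ℝ) : Set (EuclideanSpace ℝ (Fin n)) :=
  {x | ∑ i, x i ^ 2 / r i ^ 2 ≤ 1}

/-- A centered ellipsoid in `ℝⁿ`, in arbitrary position: the image under some orthogonal
transformation of an ellipsoid in standard position with positive semi-axes. -/
def IsCenteredEllipsoid {n : ℕ} (A : Set (EuclideanSpace ℝ (Fin n))) : Prop :=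
  ∃ (U : EuclideanSpace ℝ (Fin n) ≃ₗᵢ[ℝ] EuclideanSpace ℝ (Fin n)) (r : Fin n → ℝ),
    (∀ i, 0 < r i) ∧ A = U '' standardEllipsoid r

/-!
An ellipsoid is a countable intersection of symmetric strips `|⟨v, x⟩| ≤ 1`, so by continuity of
measure it suffices to treat finite intersections of strips. For these the proof is Royen's proof of
the Gaussian correlation inequality, arranged so that no density is ever used.

Let `Y` be the Gaussian vector of all linear forms `⟨v, x⟩`, with covariance `D + N`, where `D` holds
the correlations within the two families of strips and `N` those between them. Covariance `D + t N`
interpolates between independence (`t = 0`) and the given vector (`t = 1`). The joint Laplace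
transform of the `Yᵢ² / 2` is `det (1 + Λ(D + t N)) ^ (-1 / 2)`, and
`det (1 + ΛC) = ∑ J, (∏ i ∈ J, λᵢ) det C_J` (`det_one_add_diagonal_mul`). All principal minors of
`D + t N` decrease in `t ∈ [0, 1]` (`antitoneOn_det_principalMatrix`). Hence the `t`-derivative of
the Laplace transform is a nonnegative combination of `(∏ i ∈ J, λᵢ) det (1 + Λ(D + t N)) ^ (-3 / 2)`
(`hasDerivAt_inv_sqrt_det`); the power `-3 / 2` is the Laplace transform of the sum `W` of three
independent copies, and `λᵢ` acts on `exp (-λᵢ z)` as `-d/dz`.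

Indicators are replaced by functions `p (exp (-Yᵢ² / 2))` with `p` a polynomial. Their expectations
are finite combinations of values of the Laplace transform at integer points, so the derivative
formula turns termwise into a combination, with nonnegative coefficients, of expectations of
`∏ i ∈ J, u p'(u) * ∏ i ∉ J, p(u)` with `u = exp (-Wᵢ)`. It is nonnegative when `p` is nonnegative
and nondecreasing on `[0, 1]` (`gaussianPolyExpectation_le`). The polynomials
`1 - (1 - X ^ n) ^ M` with suitable `M = M(n)` have this property and converge to the indicator of
the strip (`tendsto_stepPoly_eval`), and dominated convergence finishes the proof.
-/

open Matrix MeasureTheory ProbabilityTheory Polynomial Filter Topology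

/-! ### Principal minors -/

section LinearAlgebra

variable {ι : Type*} [Fintype ι] [DecidableEq ι]

lemma det_one_add_smul_eq_prod {A : Matrix ι ι ℝ} (hA : A.IsHermitian) (t : ℝ) :
    (1 + t • A).det = ∏ i, (1 + t * hA.eigenvalues i) := by
  have h1 : 1 + t • A = (hA.eigenvectorUnitary : Matrix ι ι ℝ) *
      diagonal (fun i ↦ 1 + t * hA.eigenvalues i) *
      star (hA.eigenvectorUnitary : Matrix ι ι ℝ) := by
    have h2 : diagonal (fun i ↦ 1 + t * hA.eigenvalues i) =
        1 + t • diagonal (hA.eigenvalues) := by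
      ext i j
      by_cases h : i = j <;> simp [h]
    conv_lhs => rw [hA.spectral_theorem, Unitary.conjStarAlgAut_apply]
    rw [h2, mul_add, add_mul, mul_one, Unitary.mul_star_self_of_mem hA.eigenvectorUnitary.2,
      mul_smul_comm, smul_mul_assoc]
    rfl
  rw [h1, det_mul_right_comm, Unitary.mul_star_self_of_mem hA.eigenvectorUnitary.2, one_mul,
    det_diagonal]

/-- If `D ± N` are positive semidefinite and `det (D + t N)` is even in `t`, it decreases on
`[0, 1]`. After normalizing `D` to the identity, `N` has eigenvalues `kᵢ ∈ [-1, 1]` and evenness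
gives `det (1 + t K) ^ 2 = ∏ (1 - t ^ 2 kᵢ ^ 2)`. For singular `D` the determinant vanishes
identically. -/
lemma antitoneOn_det_add_smul {D N : Matrix ι ι ℝ}
    (hadd : (D + N).PosSemidef) (hsub : (D - N).PosSemidef)
    (heven : ∀ t : ℝ, (D - t • N).det = (D + t • N).det) :
    AntitoneOn (fun t : ℝ ↦ (D + t • N).det) (Set.Icc 0 1) := by
  have hD : D.PosSemidef := by
    have h := (hadd.add hsub).smul (show (0 : ℝ) ≤ 1 / 2 by norm_num)
    convert h using 1
    ext i j; simp; ring
  have hN : N.IsHermitian := by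
    have h := hadd.1.sub hD.1
    simpa using h
  have hpos : ∀ t ∈ Set.Icc (0 : ℝ) 1, 0 ≤ (D + t • N).det := by
    rintro t ⟨h0, h1⟩
    have h := (hD.smul (show 0 ≤ 1 - t by linarith)).add (hadd.smul h0)
    have h2 : D + t • N = (1 - t) • D + t • (D + N) := by
      ext i j; simp; ring
    rw [h2]
    exact h.det_nonneg
  by_cases hdet : D.det = 0
  · -- A kernel vector of `D` is also a kernel vector of `N`.
    obtain ⟨v, hv, hDv⟩ := exists_mulVec_eq_zero_iff.2 hdet
    have ha := hadd.dotProduct_mulVec_nonneg v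
    have hs := hsub.dotProduct_mulVec_nonneg v
    simp only [add_mulVec, sub_mulVec, hDv, zero_add, zero_sub, dotProduct_neg] at ha hs
    have h0 : star v ⬝ᵥ (D + N) *ᵥ v = 0 := by
      rw [add_mulVec, hDv, zero_add]; linarith
    have hNv : N *ᵥ v = 0 := by
      have := (hadd.dotProduct_mulVec_zero_iff v).1 h0
      simpa [add_mulVec, hDv] using this
    have hz : ∀ t : ℝ, (D + t • N).det = 0 := fun t ↦
      exists_mulVec_eq_zero_iff.1 ⟨v, hv, by simp [add_mulVec, smul_mulVec, hDv, hNv]⟩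
    intro s _ t _ _
    simp [hz]
  · obtain ⟨B, rfl⟩ : ∃ B : Matrix ι ι ℝ, D = Bᴴ * B := by
      open scoped MatrixOrder in
      exact CStarAlgebra.nonneg_iff_eq_star_mul_self.1 hD.nonneg
    have hB : IsUnit B.det := by
      rw [det_mul] at hdet
      exact isUnit_iff_ne_zero.2 (right_ne_zero_of_mul hdet)
    have hB' : IsUnit (Bᴴ).det := by
      rw [det_conjTranspose]; simpa using hB
    set K : Matrix ι ι ℝ := (B⁻¹)ᴴ * N * B⁻¹ with hK
    have hKh : K.IsHermitian := isHermitian_conjTranspose_mul_mul _ hN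
    have hfac : ∀ t : ℝ, Bᴴ * B + t • N = Bᴴ * (1 + t • K) * B := by
      intro t
      rw [mul_add, add_mul, mul_one, mul_smul_comm, smul_mul_assoc, hK, conjTranspose_nonsing_inv,
        ← mul_assoc, ← mul_assoc, mul_nonsing_inv _ hB', one_mul, mul_assoc, nonsing_inv_mul _ hB,
        mul_one]
    have hconj : ∀ t : ℝ, 1 + t • K = (B⁻¹)ᴴ * (Bᴴ * B + t • N) * B⁻¹ := by
      intro t
      rw [hfac, conjTranspose_nonsing_inv, ← mul_assoc, ← mul_assoc, nonsing_inv_mul _ hB', one_mul,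
        mul_assoc, mul_nonsing_inv _ hB, mul_one]
    have hK1 : (1 + (1 : ℝ) • K).PosSemidef := by
      rw [hconj, one_smul]
      exact hadd.conjTranspose_mul_mul_same _
    have hK2 : (1 + (-1 : ℝ) • K).PosSemidef := by
      rw [hconj, neg_one_smul, ← sub_eq_add_neg]
      exact hsub.conjTranspose_mul_mul_same _
    have hquad : ∀ (c : ℝ) i, (1 + c • K).PosSemidef → 0 ≤ 1 + c * hKh.eigenvalues i := by
      intro c i h
      have := h.dotProduct_mulVec_nonneg (WithLp.ofLp (hKh.eigenvectorBasis i))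
      have hn : WithLp.ofLp (hKh.eigenvectorBasis i) ⬝ᵥ WithLp.ofLp (hKh.eigenvectorBasis i) = 1 := by
        have := hKh.eigenvectorBasis.orthonormal.1 i
        have h2 : inner ℝ (hKh.eigenvectorBasis i) (hKh.eigenvectorBasis i) = 1 := by
          rw [real_inner_self_eq_norm_sq, this, one_pow]
        rwa [EuclideanSpace.inner_eq_star_dotProduct, star_trivial] at h2
      simpa [add_mulVec, smul_mulVec, hKh.mulVec_eigenvectorBasis, hn] using this
    have heig : ∀ i, hKh.eigenvalues i ^ 2 ≤ 1 := fun i ↦ by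
      have h1 := hquad 1 i hK1
      have h2 := hquad (-1) i hK2
      nlinarith
    have hsq : ∀ t : ℝ, (Bᴴ * B + t • N).det ^ 2 =
        (Bᴴ.det * B.det) ^ 2 * ∏ i, (1 - t ^ 2 * hKh.eigenvalues i ^ 2) := by
      intro t
      have h1 : ∀ t : ℝ, (Bᴴ * B + t • N).det =
          (Bᴴ.det * B.det) * ∏ i, (1 + t * hKh.eigenvalues i) := by
        intro t
        rw [hfac, det_mul, det_mul, det_one_add_smul_eq_prod hKh]; ring
      have h2 : (Bᴴ * B + t • N).det ^ 2 =
          (Bᴴ * B + t • N).det * (Bᴴ * B + (-t) • N).det := by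
        rw [neg_smul, ← sub_eq_add_neg, heven, sq]
      rw [h2, h1, h1, mul_mul_mul_comm, ← sq, ← Finset.prod_mul_distrib]
      congr 1
      exact Finset.prod_congr rfl fun i _ ↦ by ring
    intro s hs t ht hst
    refine le_of_sq_le_sq ?_ (hpos s hs)
    simp only [hsq]
    refine mul_le_mul_of_nonneg_left ?_ (sq_nonneg _)
    refine Finset.prod_le_prod (fun i _ ↦ ?_) (fun i _ ↦ ?_)
    · have : t ^ 2 ≤ 1 := by nlinarith [ht.1, ht.2]
      nlinarith [heig i, sq_nonneg (hKh.eigenvalues i)]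
    · have : s ^ 2 ≤ t ^ 2 := by nlinarith [hs.1]
      nlinarith [sq_nonneg (hKh.eigenvalues i)]

/-- The matrix obtained from `C` by replacing all rows and columns with index outside `J` by those
of the identity matrix. Its determinant is the principal minor of `C` on `J`. -/
def principalMatrix (J : Finset ι) (C : Matrix ι ι ℝ) : Matrix ι ι ℝ :=
  diagonal (fun i ↦ if i ∈ J then 1 else 0) * C * diagonal (fun i ↦ if i ∈ J then 1 else 0) +
    diagonal (fun i ↦ if i ∈ J then 0 else 1)

lemma principalMatrix_add_smul (J : Finset ι) (D N : Matrix ι ι ℝ) (t : ℝ) :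
    principalMatrix J (D + t • N) = principalMatrix J D +
      t • (diagonal (fun i ↦ if i ∈ J then 1 else 0) * N *
        diagonal (fun i ↦ if i ∈ J then 1 else 0)) := by
  simp only [principalMatrix, mul_add, add_mul, mul_smul_comm, smul_mul_assoc]
  abel

lemma principalMatrix_posSemidef (J : Finset ι) {C : Matrix ι ι ℝ} (hC : C.PosSemidef) :
    (principalMatrix J C).PosSemidef := by
  refine Matrix.PosSemidef.add ?_ ?_
  · have := hC.conjTranspose_mul_mul_same (diagonal (fun i ↦ if i ∈ J then (1 : ℝ) else 0))
    rwa [diagonal_conjTranspose, star_trivial] at this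
  · refine PosSemidef.diagonal fun i ↦ ?_
    dsimp
    split_ifs <;> norm_num

/-- Replacing only rows gives the same determinant: the remaining columns are cleared by
multiplication with a unipotent matrix. -/
lemma det_piecewise_row (J : Finset ι) (C : Matrix ι ι ℝ) :
    (of (J.piecewise (fun i ↦ C i) (fun i ↦ (1 : Matrix ι ι ℝ) i))).det =
      (principalMatrix J C).det := by
  set P : Matrix ι ι ℝ := diagonal (fun i ↦ if i ∈ J then (1 : ℝ) else 0) with hP
  set Q : Matrix ι ι ℝ := diagonal (fun i ↦ if i ∈ J then (0 : ℝ) else 1) with hQ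
  have hQP : Q * P = 0 := by
    ext i j
    by_cases h : i = j <;> simp [P, Q, h]
  have hQQ : Q * Q = Q := by
    ext i j
    by_cases h : i = j <;> simp [Q, h]
  have hPQ : P + Q = 1 := by
    ext i j
    by_cases h : i = j
    · subst h
      by_cases hi : i ∈ J <;> simp [P, Q, hi]
    · simp [P, Q, h]
  have h1 : of (J.piecewise (fun i ↦ C i) (fun i ↦ (1 : Matrix ι ι ℝ) i)) = P * C + Q := by
    ext i j
    by_cases hi : i ∈ J <;> simp [P, Q, hi, diagonal_mul, Matrix.one_apply, diagonal_apply]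
  have h2 : P * C + Q = (1 + P * C * Q) * (P * C * P + Q) := by
    have e1 : P * C * Q * (P * C * P) = 0 := by
      simp only [mul_assoc, ← mul_assoc Q P, hQP, zero_mul, mul_zero]
    have e2 : P * C = P * C * P + P * C * Q := by rw [← mul_add, hPQ, mul_one]
    rw [add_mul, one_mul, mul_add, e1, zero_add, mul_assoc (P * C), hQQ]
    nth_rewrite 1 [e2]
    abel
  have h3 : (1 + P * C * Q).det = 1 := by
    rw [det_one_add_mul_comm, ← mul_assoc, hQP, zero_mul, add_zero, det_one]
  rw [h1, h2, det_mul, h3, one_mul, principalMatrix]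

/-- Expansion of `det (1 + ΛC)`, `Λ` diagonal, in the principal minors of `C`. -/
lemma det_one_add_diagonal_mul (l : ι → ℝ) (C : Matrix ι ι ℝ) :
    (1 + diagonal l * C).det = ∑ J : Finset ι, (∏ i ∈ J, l i) * (principalMatrix J C).det := by
  have h := (detRowAlternating (n := ι) (R := ℝ)).toMultilinearMap.map_add_univ
    (fun i ↦ l i • C i) (fun i ↦ (1 : Matrix ι ι ℝ) i)
  have h1 : ((fun i ↦ l i • C i) + fun i ↦ (1 : Matrix ι ι ℝ) i) =
      of.symm (1 + diagonal l * C) := by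
    ext i j
    simp [diagonal_mul, add_comm]
  rw [h1] at h
  refine h.trans (Finset.sum_congr rfl fun J _ ↦ ?_)
  rw [← det_piecewise_row, ← smul_eq_mul]
  refine Eq.trans ?_ ((detRowAlternating (n := ι) (R := ℝ)).toMultilinearMap.map_piecewise_smul
    l (J.piecewise (fun i ↦ C i) (fun i ↦ (1 : Matrix ι ι ℝ) i)) J)
  congr 1
  ext i j
  by_cases hi : i ∈ J <;> simp [hi]

lemma det_one_add_diagonal_mul_pos {l : ι → ℝ} (hl : ∀ i, 0 ≤ l i) {C : Matrix ι ι ℝ}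
    (hC : C.PosSemidef) : 0 < (1 + diagonal l * C).det := by
  rw [det_one_add_diagonal_mul, ← Finset.add_sum_erase _ _ (Finset.mem_univ ∅)]
  have h : (principalMatrix ∅ C).det = 1 := by
    simp [principalMatrix]
  have : 0 ≤ ∑ J ∈ Finset.univ.erase (∅ : Finset ι),
      (∏ i ∈ J, l i) * (principalMatrix J C).det :=
    Finset.sum_nonneg fun J _ ↦ mul_nonneg (Finset.prod_nonneg fun i _ ↦ hl i)
      (principalMatrix_posSemidef J hC).det_nonneg
  simp only [Finset.prod_empty, h, one_mul]
  linarith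

lemma posSemidef_sub_of_sign_conj {D N : Matrix ι ι ℝ} {s : ι → ℝ}
    (hD : diagonal s * D * diagonal s = D) (hN : diagonal s * N * diagonal s = -N)
    (hadd : (D + N).PosSemidef) : (D - N).PosSemidef := by
  have := hadd.conjTranspose_mul_mul_same (diagonal s)
  rwa [diagonal_conjTranspose, star_trivial, mul_add, add_mul, hD, hN, ← sub_eq_add_neg] at this

/-- Every principal minor of `D + t N` decreases in `t ∈ [0, 1]`. The signs `s` mark two groups of
indices: `D` has no entries between the groups and `N` none within them, so conjugation by
`diagonal s` turns `t` into `-t`. -/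
lemma antitoneOn_det_principalMatrix {D N : Matrix ι ι ℝ} {s : ι → ℝ} (hs : ∀ i, s i * s i = 1)
    (hD : diagonal s * D * diagonal s = D) (hN : diagonal s * N * diagonal s = -N)
    (hadd : (D + N).PosSemidef) (J : Finset ι) :
    AntitoneOn (fun t : ℝ ↦ (principalMatrix J (D + t • N)).det) (Set.Icc 0 1) := by
  have hss : diagonal s * diagonal s = (1 : Matrix ι ι ℝ) := by
    rw [diagonal_mul_diagonal, ← diagonal_one]; simp [hs]
  have hsub := posSemidef_sub_of_sign_conj hD hN hadd
  have hconj : ∀ C : Matrix ι ι ℝ, principalMatrix J (diagonal s * C * diagonal s) =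
      diagonal s * principalMatrix J C * diagonal s := by
    intro C
    ext i j
    by_cases hij : i = j
    · subst hij
      by_cases hi : i ∈ J <;> simp [principalMatrix, hi, hs]
    · simp [principalMatrix, hij]
  simp only [principalMatrix_add_smul]
  refine antitoneOn_det_add_smul ?_ ?_ fun t ↦ ?_
  · have := principalMatrix_posSemidef J hadd
    rwa [← one_smul ℝ N, principalMatrix_add_smul, one_smul] at this
  · have := principalMatrix_posSemidef J hsub
    rwa [sub_eq_add_neg, ← neg_one_smul ℝ N, principalMatrix_add_smul, neg_one_smul,
      ← sub_eq_add_neg] at this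
  · rw [sub_eq_add_neg, ← neg_smul, ← principalMatrix_add_smul, ← principalMatrix_add_smul]
    have : D + -t • N = diagonal s * (D + t • N) * diagonal s := by
      rw [mul_add, add_mul, mul_smul_comm, smul_mul_assoc, hD, hN, smul_neg, neg_smul]
    rw [this, hconj, det_mul_right_comm, hss, one_mul]

end LinearAlgebra

/-! ### Laplace transforms of squared Gaussian vectors -/

section GaussianLaplace

lemma integral_exp_neg_mul_sq_gaussianReal {m : ℝ} (hm : 0 ≤ m) :
    ∫ y, Real.exp (-(m * y ^ 2) / 2) ∂(gaussianReal 0 1) = (√(1 + m))⁻¹ := by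
  rw [integral_gaussianReal_eq_integral_smul one_ne_zero]
  have h : ∀ y : ℝ, gaussianPDFReal 0 1 y • Real.exp (-(m * y ^ 2) / 2) =
      (√(2 * Real.pi))⁻¹ * Real.exp (-((1 + m) / 2) * y ^ 2) := by
    intro y
    rw [gaussianPDFReal, smul_eq_mul, mul_assoc, ← Real.exp_add]
    simp only [NNReal.coe_one, mul_one, sub_zero]
    congr 2
    ring
  simp_rw [h]
  rw [integral_const_mul, integral_gaussian, ← Real.sqrt_inv, ← Real.sqrt_inv,
    ← Real.sqrt_mul (by positivity)]
  congr 1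
  have := Real.pi_ne_zero
  field_simp

variable {ι m : Type*} [Fintype ι] [DecidableEq ι] [Fintype m] [DecidableEq m]

lemma integral_exp_neg_quadratic_stdGaussian {M : Matrix m m ℝ} (hM : M.PosSemidef) :
    ∫ x, Real.exp (-(WithLp.ofLp x ⬝ᵥ M *ᵥ WithLp.ofLp x) / 2)
      ∂(stdGaussian (EuclideanSpace ℝ m)) = (√(1 + M).det)⁻¹ := by
  have hdet := det_one_add_smul_eq_prod hM.1 1
  simp only [one_smul, one_mul] at hdet
  set b := hM.1.eigenvectorBasis with hb
  set e := hM.1.eigenvalues with he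
  rw [stdGaussian_eq_map_pi_orthonormalBasis b, integral_map (Measurable.aemeasurable (by fun_prop))
    (Continuous.aestronglyMeasurable (by fun_prop))]
  have hq : ∀ y : m → ℝ, WithLp.ofLp (∑ i, y i • b i) ⬝ᵥ M *ᵥ WithLp.ofLp (∑ i, y i • b i) =
      ∑ i, e i * y i ^ 2 := by
    intro y
    have h1 : M *ᵥ WithLp.ofLp (∑ i, y i • b i) = WithLp.ofLp (∑ i, (e i * y i) • b i) := by
      simp only [WithLp.ofLp_sum, WithLp.ofLp_smul, mulVec_sum, mulVec_smul]
      refine Finset.sum_congr rfl fun i _ ↦ ?_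
      rw [hb, hM.1.mulVec_eigenvectorBasis, smul_smul, mul_comm]
    have h2 := EuclideanSpace.inner_eq_star_dotProduct (𝕜 := ℝ) (∑ i, (e i * y i) • b i)
      (∑ i, y i • b i)
    rw [star_trivial] at h2
    rw [h1, ← h2, b.orthonormal.inner_sum]
    refine Finset.sum_congr rfl fun i _ ↦ ?_
    simp; ring
  simp_rw [hq, ← Finset.sum_neg_distrib, Finset.sum_div, Real.exp_sum]
  rw [integral_fintype_prod_eq_prod (f := fun i (y : ℝ) ↦ Real.exp (-(e i * y ^ 2) / 2)), hdet,
    Real.sqrt_eq_rpow, ← Real.finsetProd_rpow _ _ fun i _ ↦ by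
      have := hM.eigenvalues_nonneg i
      positivity, ← Finset.prod_inv_distrib]
  refine Finset.prod_congr rfl fun i _ ↦ ?_
  rw [integral_exp_neg_mul_sq_gaussianReal (hM.eigenvalues_nonneg i), Real.sqrt_eq_rpow]

/-- The joint Laplace transform of the halved squares of the coordinates of the Gaussian vector `V x`. -/
lemma integral_exp_neg_sum_sq_stdGaussian (V : Matrix ι m ℝ) {l : ι → ℝ} (hl : ∀ i, 0 ≤ l i) :
    ∫ x, Real.exp (-(∑ i, l i * (V *ᵥ WithLp.ofLp x) i ^ 2) / 2)
      ∂(stdGaussian (EuclideanSpace ℝ m)) = (√(1 + diagonal l * (V * Vᵀ)).det)⁻¹ := by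
  have hM : (Vᵀ * diagonal l * V).PosSemidef := by
    have := (PosSemidef.diagonal hl).conjTranspose_mul_mul_same V
    rwa [conjTranspose_eq_transpose_of_trivial] at this
  have hq : ∀ v : m → ℝ, ∑ i, l i * (V *ᵥ v) i ^ 2 = v ⬝ᵥ (Vᵀ * diagonal l * V) *ᵥ v := by
    intro v
    rw [← mulVec_mulVec, ← mulVec_mulVec, dotProduct_mulVec, vecMul_transpose]
    simp only [dotProduct, mulVec_diagonal]
    exact Finset.sum_congr rfl fun i _ ↦ by ring
  simp_rw [hq]
  rw [integral_exp_neg_quadratic_stdGaussian hM, Matrix.mul_assoc, det_one_add_mul_comm, Matrix.mul_assoc]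

/-- The Laplace transform at integer points, as moments of `exp (-(V x)ᵢ² / 2)`. -/
lemma integral_prod_exp_pow_stdGaussian (V : Matrix ι m ℝ) (k : ι → ℕ) :
    ∫ x, ∏ i, Real.exp (-(V *ᵥ WithLp.ofLp x) i ^ 2 / 2) ^ k i
      ∂(stdGaussian (EuclideanSpace ℝ m)) =
      (√(1 + diagonal (fun i ↦ (k i : ℝ)) * (V * Vᵀ)).det)⁻¹ := by
  rw [← integral_exp_neg_sum_sq_stdGaussian V fun i ↦ Nat.cast_nonneg (k i)]
  simp_rw [← Finset.sum_neg_distrib, Finset.sum_div, Real.exp_sum, ← Real.exp_nat_mul]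
  refine integral_congr_ae (.of_forall fun x ↦ Finset.prod_congr rfl fun i _ ↦ ?_)
  congr 1
  ring

/-- Expectations of products of polynomials in `[0, 1]`-valued variables are linear combinations of
joint moments. -/
lemma sum_coeff_mul_moment_eq_integral {Ω : Type*} [MeasurableSpace Ω] (μ : Measure Ω)
    [IsProbabilityMeasure μ] {u : Ω → ι → ℝ} (hu : Measurable u)
    (hu01 : ∀ ω i, u ω i ∈ Set.Icc (0 : ℝ) 1) {ψ : (ι → ℕ) → ℝ}
    (hψ : ∀ k, ∫ ω, ∏ i, u ω i ^ k i ∂μ = ψ k)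
    (q : ι → ℝ[X]) (d : ι → ℕ) (hd : ∀ i, (q i).natDegree < d i) :
    ∑ k ∈ Fintype.piFinset fun i ↦ Finset.range (d i), (∏ i, (q i).coeff (k i)) * ψ k =
      ∫ ω, ∏ i, (q i).eval (u ω i) ∂μ := by
  have h : ∀ ω, ∏ i, (q i).eval (u ω i) = ∑ k ∈ Fintype.piFinset fun i ↦ Finset.range (d i),
      (∏ i, (q i).coeff (k i)) * ∏ i, u ω i ^ k i := by
    intro ω
    simp_rw [fun i ↦ eval_eq_sum_range' (hd i) (u ω i), ← Finset.prod_mul_distrib]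
    exact Finset.prod_univ_sum _ _
  simp_rw [h]
  rw [integral_finsetSum]
  · simp_rw [integral_const_mul, hψ]
  · intro k _
    refine Integrable.const_mul (Integrable.of_bound (C := 1) ?_ (.of_forall fun ω ↦ ?_)) _
    · exact Measurable.aestronglyMeasurable (Finset.measurable_prod _ fun i _ ↦
        ((measurable_pi_apply i).comp hu).pow_const _)
    · rw [Real.norm_of_nonneg (Finset.prod_nonneg fun i _ ↦ pow_nonneg (hu01 ω i).1 _)]
      exact Finset.prod_le_one (fun i _ ↦ pow_nonneg (hu01 ω i).1 _)
        fun i _ ↦ pow_le_one₀ (hu01 ω i).1 (hu01 ω i).2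

end GaussianLaplace

/-! ### Monotonicity along the interpolation -/

section Interpolation

variable {ι : Type*} [Fintype ι] [DecidableEq ι]

lemma differentiable_det_principalMatrix (J : Finset ι) (D N : Matrix ι ι ℝ) :
    Differentiable ℝ fun t : ℝ ↦ (principalMatrix J (D + t • N)).det := by
  simp only [principalMatrix_add_smul, det_apply, Matrix.add_apply, Matrix.smul_apply]
  fun_prop

/-- Derivative in `t` of the Laplace transform `det (1 + Λ(D + t N)) ^ (-1 / 2)`. The factor
`∏ i ∈ J, l i` acts on exponentials as a differentiation in the variables of `J`, and the exponent
`-3 / 2` belongs to the sum of three independent copies. -/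
lemma hasDerivAt_inv_sqrt_det (D N : Matrix ι ι ℝ) {l : ι → ℝ} (hl : ∀ i, 0 ≤ l i) {t : ℝ}
    (ht : (D + t • N).PosSemidef) :
    HasDerivAt (fun t : ℝ ↦ (√(1 + diagonal l * (D + t • N)).det)⁻¹)
      (1 / 2 * ∑ J : Finset ι, -deriv (fun t : ℝ ↦ (principalMatrix J (D + t • N)).det) t *
        ((∏ i ∈ J, l i) * (√(1 + diagonal l * (D + t • N)).det)⁻¹ ^ 3)) t := by
  have hpos := det_one_add_diagonal_mul_pos hl ht
  have hder : HasDerivAt (fun t : ℝ ↦ (1 + diagonal l * (D + t • N)).det)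
      (∑ J : Finset ι, (∏ i ∈ J, l i) *
        deriv (fun t : ℝ ↦ (principalMatrix J (D + t • N)).det) t) t := by
    simp_rw [det_one_add_diagonal_mul]
    exact HasDerivAt.fun_sum fun J _ ↦
      (differentiable_det_principalMatrix J D N t).hasDerivAt.const_mul _
  refine ((hder.sqrt hpos.ne').inv (Real.sqrt_pos.2 hpos).ne').congr_deriv ?_
  have hs := Real.sqrt_pos.2 hpos
  have h1 : (1 : ℝ) / 2 * ∑ J : Finset ι,
      -deriv (fun t : ℝ ↦ (principalMatrix J (D + t • N)).det) t *
        ((∏ i ∈ J, l i) * (√(1 + diagonal l * (D + t • N)).det)⁻¹ ^ 3) =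
      -(1 / 2) * (√(1 + diagonal l * (D + t • N)).det)⁻¹ ^ 3 * ∑ J : Finset ι, (∏ i ∈ J, l i) *
        deriv (fun t : ℝ ↦ (principalMatrix J (D + t • N)).det) t := by
    rw [Finset.mul_sum, Finset.mul_sum]
    exact Finset.sum_congr rfl fun J _ ↦ by ring
  rw [h1]
  field_simp

/-- The expectation of `∏ pᵢ (exp (-Yᵢ² / 2))` for a centered Gaussian vector `Y` with covariance
matrix `C`, written as a combination of values of the Laplace transform of `(Yᵢ²)ᵢ`. -/
noncomputable def gaussianPolyExpectation (p : ι → ℝ[X]) (C : Matrix ι ι ℝ) : ℝ :=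
  ∑ k ∈ Fintype.piFinset fun i ↦ Finset.range ((p i).natDegree + 1),
    (∏ i, (p i).coeff (k i)) * (√(1 + diagonal (fun i ↦ (k i : ℝ)) * C).det)⁻¹

/-- Removing the correlation between the two groups of coordinates marked by the signs `s` does not
increase the expectation of `∏ pᵢ (exp (-Yᵢ² / 2))`, if the `pᵢ` are nonnegative and nondecreasing
on `[0, 1]`. -/
lemma gaussianPolyExpectation_le {D N : Matrix ι ι ℝ} {s : ι → ℝ} (hs : ∀ i, s i * s i = 1)
    (hD : diagonal s * D * diagonal s = D) (hN : diagonal s * N * diagonal s = -N)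
    (hadd : (D + N).PosSemidef) (p : ι → ℝ[X])
    (hp : ∀ i, ∀ u ∈ Set.Icc (0 : ℝ) 1, 0 ≤ (p i).eval u)
    (hp' : ∀ i, ∀ u ∈ Set.Icc (0 : ℝ) 1, 0 ≤ (derivative (p i)).eval u) :
    gaussianPolyExpectation p D ≤ gaussianPolyExpectation p (D + N) := by
  have hsub := posSemidef_sub_of_sign_conj hD hN hadd
  have hpsd : ∀ t ∈ Set.Icc (0 : ℝ) 1, (D + t • N).PosSemidef := by
    rintro t ⟨h0, h1⟩
    have h := (hadd.smul (show 0 ≤ (1 + t) / 2 by linarith)).add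
      (hsub.smul (show 0 ≤ (1 - t) / 2 by linarith))
    convert h using 1
    ext i j; simp; ring
  -- `u p'(u)` has coefficients `k * p.coeff k`, the `l i` of the Laplace transform at `l = k`.
  let q : Finset ι → ι → ℝ[X] := fun J i ↦ if i ∈ J then X * derivative (p i) else p i
  have hq : ∀ J (k : ι → ℕ), ∏ i, (q J i).coeff (k i) =
      (∏ i, (p i).coeff (k i)) * ∏ i ∈ J, (k i : ℝ) := by
    intro J k
    rw [← Fintype.prod_ite_mem J fun i ↦ (k i : ℝ), ← Finset.prod_mul_distrib]
    refine Finset.prod_congr rfl fun i _ ↦ ?_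
    by_cases hi : i ∈ J
    · simp only [q, hi, if_true]
      cases hk : k i with
      | zero => simp
      | succ n => simp [coeff_X_mul, coeff_derivative]
    · simp [q, hi]
  have hqdeg : ∀ J i, (q J i).natDegree < (p i).natDegree + 1 := by
    intro J i
    by_cases hi : i ∈ J
    · simp only [q, hi, if_true]
      by_cases h0 : (p i).natDegree = 0
      · rw [derivative_of_natDegree_zero h0]; simp
      · have h1 := natDegree_mul_le (p := (X : ℝ[X])) (q := derivative (p i))
        rw [natDegree_X] at h1
        have h2 := natDegree_derivative_lt h0
        omega
    · simp [q, hi]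
  have hq0 : ∀ J i, ∀ u ∈ Set.Icc (0 : ℝ) 1, 0 ≤ (q J i).eval u := by
    intro J i u hu
    by_cases hi : i ∈ J
    · simp only [q, hi, if_true, eval_mul, eval_X]
      exact mul_nonneg hu.1 (hp' i u hu)
    · simpa [q, hi] using hp i u hu
  have hderiv : ∀ t ∈ Set.Icc (0 : ℝ) 1,
      HasDerivAt (fun t : ℝ ↦ gaussianPolyExpectation p (D + t • N))
      (1 / 2 * ∑ J : Finset ι, -deriv (fun t : ℝ ↦ (principalMatrix J (D + t • N)).det) t *
        ∑ k ∈ Fintype.piFinset fun i ↦ Finset.range ((p i).natDegree + 1),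
          (∏ i, (q J i).coeff (k i)) *
            (√(1 + diagonal (fun i ↦ (k i : ℝ)) * (D + t • N)).det)⁻¹ ^ 3) t := by
    intro t ht
    have h := HasDerivAt.fun_sum (u := Fintype.piFinset fun i ↦ Finset.range ((p i).natDegree + 1))
      fun k _ ↦ (hasDerivAt_inv_sqrt_det D N (fun i ↦ Nat.cast_nonneg (k i)) (hpsd t ht)).const_mul
        (∏ i, (p i).coeff (k i))
    refine h.congr_deriv ?_
    simp_rw [hq, Finset.mul_sum]
    rw [Finset.sum_comm]
    exact Finset.sum_congr rfl fun k _ ↦ Finset.sum_congr rfl fun J _ ↦ by ring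
  have hnonneg : ∀ t ∈ Set.Ioo (0 : ℝ) 1,
      0 ≤ 1 / 2 * ∑ J : Finset ι, -deriv (fun t : ℝ ↦ (principalMatrix J (D + t • N)).det) t *
        ∑ k ∈ Fintype.piFinset fun i ↦ Finset.range ((p i).natDegree + 1),
          (∏ i, (q J i).coeff (k i)) *
            (√(1 + diagonal (fun i ↦ (k i : ℝ)) * (D + t • N)).det)⁻¹ ^ 3 := by
    intro t ht
    refine mul_nonneg (by norm_num) (Finset.sum_nonneg fun J _ ↦ mul_nonneg ?_ ?_)
    · have hanti := antitoneOn_det_principalMatrix hs hD hN hadd J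
      have := hanti.derivWithin_nonpos (x := t)
      rw [derivWithin_of_mem_nhds (Icc_mem_nhds ht.1 ht.2)] at this
      linarith
    · obtain ⟨B, hB⟩ : ∃ B : Matrix ι ι ℝ, D + t • N = Bᴴ * B := by
        open scoped MatrixOrder in
        exact CStarAlgebra.nonneg_iff_eq_star_mul_self.1 (hpsd t ⟨ht.1.le, ht.2.le⟩).nonneg
      -- The cube of the Laplace transform belongs to the sum of three independent copies.
      let w : (Fin 3 → EuclideanSpace ℝ ι) → ι → ℝ := fun x i ↦
        ∏ r, Real.exp (-(Bᴴ *ᵥ WithLp.ofLp (x r)) i ^ 2 / 2)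
      have hw01 : ∀ x i, w x i ∈ Set.Icc (0 : ℝ) 1 := fun x i ↦
        ⟨Finset.prod_nonneg fun r _ ↦ (Real.exp_pos _).le,
          Finset.prod_le_one (fun r _ ↦ (Real.exp_pos _).le) fun r _ ↦ by
            rw [Real.exp_le_one_iff]
            have := sq_nonneg ((Bᴴ *ᵥ WithLp.ofLp (x r)) i)
            linarith⟩
      have hw : Measurable w := by
        refine Continuous.measurable ?_
        simp only [w]
        fun_prop
      have hmom : ∀ k : ι → ℕ, ∫ x, ∏ i, w x i ^ k i
          ∂(Measure.pi fun _ : Fin 3 ↦ stdGaussian (EuclideanSpace ℝ ι)) =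
          (√(1 + diagonal (fun i ↦ (k i : ℝ)) * (D + t • N)).det)⁻¹ ^ 3 := by
        intro k
        simp only [w, ← Finset.prod_pow]
        simp_rw [Finset.prod_comm (s := (Finset.univ : Finset ι))]
        rw [integral_fintype_prod_eq_pow (ι := Fin 3) (fun x : EuclideanSpace ℝ ι ↦
          ∏ i, Real.exp (-(Bᴴ *ᵥ WithLp.ofLp x) i ^ 2 / 2) ^ k i),
          integral_prod_exp_pow_stdGaussian, hB, Fintype.card_fin,
          conjTranspose_eq_transpose_of_trivial, transpose_transpose]
      rw [sum_coeff_mul_moment_eq_integral _ hw hw01 hmom _ _ (hqdeg J)]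
      exact integral_nonneg fun x ↦ Finset.prod_nonneg fun i _ ↦ hq0 J i _ (hw01 x i)
  have hmono : MonotoneOn (fun t : ℝ ↦ gaussianPolyExpectation p (D + t • N)) (Set.Icc 0 1) := by
    refine monotoneOn_of_deriv_nonneg (convex_Icc 0 1)
      (fun t ht ↦ (hderiv t ht).continuousAt.continuousWithinAt) ?_ ?_
    · intro t ht
      exact (hderiv t (interior_subset ht)).differentiableAt.differentiableWithinAt
    · intro t ht
      rw [(hderiv t (interior_subset ht)).deriv]
      rw [interior_Icc] at ht
      exact hnonneg t ht
  have := hmono (Set.left_mem_Icc.2 zero_le_one) (Set.right_mem_Icc.2 zero_le_one) zero_le_one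
  simpa using this

end Interpolation

/-! ### Polynomial approximation of an indicator -/

/-- Polynomials increasing from `0` to `1` on `[0, 1]` that converge there to the indicator of
`[exp (-1 / 2), 1]`. -/
noncomputable def stepPoly (n : ℕ) : ℝ[X] :=
  1 - (1 - X ^ n) ^ ⌈(n : ℝ) / Real.exp (-1 / 2) ^ n⌉₊

lemma stepPoly_eval (n : ℕ) (u : ℝ) :
    (stepPoly n).eval u = 1 - (1 - u ^ n) ^ ⌈(n : ℝ) / Real.exp (-1 / 2) ^ n⌉₊ := by
  simp [stepPoly]

lemma stepPoly_eval_mem_Icc (n : ℕ) {u : ℝ} (hu : u ∈ Set.Icc (0 : ℝ) 1) :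
    (stepPoly n).eval u ∈ Set.Icc (0 : ℝ) 1 := by
  have h0 : 0 ≤ 1 - u ^ n := sub_nonneg.2 (pow_le_one₀ hu.1 hu.2)
  have h1 : 1 - u ^ n ≤ 1 := sub_le_self _ (pow_nonneg hu.1 n)
  rw [stepPoly_eval]
  exact ⟨sub_nonneg.2 (pow_le_one₀ h0 h1), sub_le_self _ (pow_nonneg h0 _)⟩

lemma stepPoly_derivative_eval_nonneg (n : ℕ) {u : ℝ} (hu : u ∈ Set.Icc (0 : ℝ) 1) :
    0 ≤ (derivative (stepPoly n)).eval u := by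
  have h0 : 0 ≤ 1 - u ^ n := sub_nonneg.2 (pow_le_one₀ hu.1 hu.2)
  have h1 := hu.1
  simp only [stepPoly, derivative_sub, derivative_one, derivative_pow, derivative_X, zero_sub,
    eval_mul, eval_pow, eval_sub, eval_one, eval_X, eval_C, mul_one, mul_neg, neg_neg]
  positivity

lemma tendsto_stepPoly_eval {u : ℝ} (hu : u ∈ Set.Icc (0 : ℝ) 1) :
    Tendsto (fun n ↦ (stepPoly n).eval u) atTop (𝓝 (if Real.exp (-1 / 2) ≤ u then 1 else 0)) := by
  set c := Real.exp (-1 / 2) with hc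
  have hc0 : 0 < c := Real.exp_pos _
  have hu0 := hu.1
  simp only [stepPoly_eval, ← hc]
  have hb0 : ∀ n : ℕ, 0 ≤ 1 - u ^ n := fun n ↦ sub_nonneg.2 (pow_le_one₀ hu.1 hu.2)
  split_ifs with h
  · have key : Tendsto (fun n : ℕ ↦ (1 - u ^ n) ^ ⌈(n : ℝ) / c ^ n⌉₊) atTop (𝓝 0) := by
      refine squeeze_zero (fun n ↦ pow_nonneg (hb0 n) _) (fun n ↦ ?_)
        (Real.tendsto_exp_neg_atTop_nhds_zero.comp tendsto_natCast_atTop_atTop)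
      have h1 : 1 - u ^ n ≤ Real.exp (-u ^ n) := Real.one_sub_le_exp_neg _
      refine (pow_le_pow_left₀ (hb0 n) h1 _).trans ?_
      rw [← Real.exp_nat_mul, Function.comp_apply, Real.exp_le_exp]
      have h2 : (n : ℝ) / c ^ n ≤ ⌈(n : ℝ) / c ^ n⌉₊ := Nat.le_ceil _
      have h3 : c ^ n ≤ u ^ n := pow_le_pow_left₀ hc0.le h n
      have h4 : (n : ℝ) ≤ ⌈(n : ℝ) / c ^ n⌉₊ * c ^ n := (div_le_iff₀ (by positivity)).1 h2
      have h5 := mul_le_mul_of_nonneg_left h3 (Nat.cast_nonneg (α := ℝ) ⌈(n : ℝ) / c ^ n⌉₊)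
      linarith
    simpa using key.const_sub 1
  · push Not at h
    have huc : u / c < 1 := (div_lt_one hc0).2 h
    have huc0 : 0 ≤ u / c := by positivity
    have hu1 : u < 1 := h.trans_le (by rw [hc, Real.exp_le_one_iff]; norm_num)
    have key := (tendsto_self_mul_const_pow_of_lt_one huc0 huc).add
      (tendsto_pow_atTop_nhds_zero_of_lt_one hu0 hu1)
    rw [add_zero] at key
    refine squeeze_zero (fun n ↦ sub_nonneg.2 (pow_le_one₀ (hb0 n)
      (sub_le_self _ (pow_nonneg hu0 n)))) (fun n ↦ ?_) key
    have h1 := one_add_mul_le_pow (a := -u ^ n) (by have := hb0 n; linarith) ⌈(n : ℝ) / c ^ n⌉₊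
    have h2 : (⌈(n : ℝ) / c ^ n⌉₊ : ℝ) < n / c ^ n + 1 := Nat.ceil_lt_add_one (by positivity)
    have h3 := mul_le_mul_of_nonneg_right h2.le (pow_nonneg hu0 n)
    have h4 : (n / c ^ n + 1) * u ^ n = n * (u / c) ^ n + u ^ n := by
      rw [div_pow]; ring
    rw [← sub_eq_add_neg] at h1
    linarith

/-! ### Intersections of strips -/

section Strips

variable {ι κ m : Type*} [Fintype m]

/-- The function `exp (-(V x)ᵢ² / 2)` on Euclidean space, with values in `(0, 1]`. -/
noncomputable def gaussianProfile (V : Matrix ι m ℝ) (x : EuclideanSpace ℝ m) (i : ι) : ℝ :=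
  Real.exp (-(V *ᵥ WithLp.ofLp x) i ^ 2 / 2)

lemma gaussianProfile_mem_Icc (V : Matrix ι m ℝ) (x : EuclideanSpace ℝ m) (i : ι) :
    gaussianProfile V x i ∈ Set.Icc (0 : ℝ) 1 := by
  refine ⟨(Real.exp_pos _).le, Real.exp_le_one_iff.2 ?_⟩
  have := sq_nonneg ((V *ᵥ WithLp.ofLp x) i)
  linarith

lemma continuous_gaussianProfile (V : Matrix ι m ℝ) : Continuous (gaussianProfile V) := by
  unfold gaussianProfile
  fun_prop

/-- The intersection of the symmetric strips `|(V x)ᵢ| ≤ 1`. -/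
def stripInter (V : Matrix ι m ℝ) : Set (EuclideanSpace ℝ m) :=
  {x | ∀ i, |(V *ᵥ WithLp.ofLp x) i| ≤ 1}

lemma isClosed_stripInter (V : Matrix ι m ℝ) : IsClosed (stripInter V) := by
  simp only [stripInter, Set.ofPred_forall]
  refine isClosed_iInter fun i ↦ isClosed_le ?_ continuous_const
  simp only [mulVec, dotProduct]
  fun_prop

variable [Fintype ι]

lemma tendsto_prod_stepPoly (V : Matrix ι m ℝ) (x : EuclideanSpace ℝ m) :
    Tendsto (fun n ↦ ∏ i, (stepPoly n).eval (gaussianProfile V x i)) atTop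
      (𝓝 ((stripInter V).indicator 1 x)) := by
  have h : (stripInter V).indicator (1 : EuclideanSpace ℝ m → ℝ) x =
      ∏ i, if Real.exp (-1 / 2) ≤ gaussianProfile V x i then (1 : ℝ) else 0 := by
    have hiff : ∀ i, Real.exp (-1 / 2) ≤ gaussianProfile V x i ↔
        |(V *ᵥ WithLp.ofLp x) i| ≤ 1 := by
      intro i
      rw [gaussianProfile, Real.exp_le_exp, ← sq_le_one_iff_abs_le_one]
      constructor <;> intro h <;> linarith
    simp only [hiff, Finset.prod_ite_zero, Finset.prod_const_one, Set.indicator_apply, stripInter,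
      Set.mem_ofPred_eq, Finset.mem_univ, true_imp_iff, Pi.one_apply]
  rw [h]
  exact tendsto_finsetProd _ fun i _ ↦ tendsto_stepPoly_eval (gaussianProfile_mem_Icc V x i)

lemma prod_stepPoly_mem_Icc (V : Matrix ι m ℝ) (x : EuclideanSpace ℝ m) (n : ℕ) :
    ∏ i, (stepPoly n).eval (gaussianProfile V x i) ∈ Set.Icc (0 : ℝ) 1 :=
  ⟨Finset.prod_nonneg fun i _ ↦ (stepPoly_eval_mem_Icc n (gaussianProfile_mem_Icc V x i)).1,
    Finset.prod_le_one (fun i _ ↦ (stepPoly_eval_mem_Icc n (gaussianProfile_mem_Icc V x i)).1)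
      fun i _ ↦ (stepPoly_eval_mem_Icc n (gaussianProfile_mem_Icc V x i)).2⟩

lemma continuous_prod_stepPoly (V : Matrix ι m ℝ) (n : ℕ) :
    Continuous fun x ↦ ∏ i, (stepPoly n).eval (gaussianProfile V x i) :=
  continuous_finsetProd _ fun i _ ↦ (stepPoly n).continuous.comp
    ((continuous_apply i).comp (continuous_gaussianProfile V))

variable [DecidableEq m] [DecidableEq ι] [Fintype κ] [DecidableEq κ]

lemma integral_prod_eval_gaussianProfile (V : Matrix ι m ℝ) (p : ι → ℝ[X]) :
    ∫ x, ∏ i, (p i).eval (gaussianProfile V x i) ∂(stdGaussian (EuclideanSpace ℝ m)) =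
      gaussianPolyExpectation p (V * Vᵀ) :=
  (sum_coeff_mul_moment_eq_integral _ (continuous_gaussianProfile V).measurable
    (gaussianProfile_mem_Icc V) (integral_prod_exp_pow_stdGaussian V) p _
    fun _ ↦ Nat.lt_succ_self _).symm

/-- The correlation inequality for products of increasing polynomials of `exp (-(V x)ᵢ² / 2)`. The left
side is the uncorrelated case, realized on a product of two Gaussian spaces. -/
lemma integral_prod_eval_mul_le (V : Matrix ι m ℝ) (W : Matrix κ m ℝ) (p : ℝ[X])
    (hp : ∀ u ∈ Set.Icc (0 : ℝ) 1, 0 ≤ p.eval u)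
    (hp' : ∀ u ∈ Set.Icc (0 : ℝ) 1, 0 ≤ (derivative p).eval u) :
    (∫ x, ∏ i, p.eval (gaussianProfile V x i) ∂(stdGaussian (EuclideanSpace ℝ m))) *
        ∫ x, ∏ j, p.eval (gaussianProfile W x j) ∂(stdGaussian (EuclideanSpace ℝ m)) ≤
      ∫ x, (∏ i, p.eval (gaussianProfile V x i)) * ∏ j, p.eval (gaussianProfile W x j)
        ∂(stdGaussian (EuclideanSpace ℝ m)) := by
  set D : Matrix (ι ⊕ κ) (ι ⊕ κ) ℝ := fromBlocks (V * Vᵀ) 0 0 (W * Wᵀ) with hD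
  set N : Matrix (ι ⊕ κ) (ι ⊕ κ) ℝ := fromBlocks 0 (V * Wᵀ) (W * Vᵀ) 0 with hN
  have hDN : D + N = fromRows V W * (fromRows V W)ᵀ := by
    rw [hD, hN, fromBlocks_add, transpose_fromRows, fromRows_mul_fromCols]
    simp
  have hright : ∫ x, (∏ i, p.eval (gaussianProfile V x i)) * ∏ j, p.eval (gaussianProfile W x j)
        ∂(stdGaussian (EuclideanSpace ℝ m)) = gaussianPolyExpectation (fun _ ↦ p) (D + N) := by
    rw [hDN, ← integral_prod_eval_gaussianProfile]
    simp [Fintype.prod_sum_type, gaussianProfile, fromRows_mulVec]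
  have hleft : (∫ x, ∏ i, p.eval (gaussianProfile V x i) ∂(stdGaussian (EuclideanSpace ℝ m))) *
        ∫ x, ∏ j, p.eval (gaussianProfile W x j) ∂(stdGaussian (EuclideanSpace ℝ m)) =
      gaussianPolyExpectation (fun _ ↦ p) D := by
    rw [← integral_prod_mul]
    let w : EuclideanSpace ℝ m × EuclideanSpace ℝ m → ι ⊕ κ → ℝ := fun z ↦
      Sum.elim (gaussianProfile V z.1) (gaussianProfile W z.2)
    have hw : Measurable w := by
      refine measurable_pi_iff.2 ?_
      rintro (i | j)
      · exact ((measurable_pi_apply i).comp (continuous_gaussianProfile V).measurable).comp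
          measurable_fst
      · exact ((measurable_pi_apply j).comp (continuous_gaussianProfile W).measurable).comp
          measurable_snd
    have hw01 : ∀ z i, w z i ∈ Set.Icc (0 : ℝ) 1 := by
      rintro z (i | j)
      exacts [gaussianProfile_mem_Icc V z.1 i, gaussianProfile_mem_Icc W z.2 j]
    have hmom : ∀ k : ι ⊕ κ → ℕ, ∫ z, ∏ i, w z i ^ k i
        ∂((stdGaussian (EuclideanSpace ℝ m)).prod (stdGaussian (EuclideanSpace ℝ m))) =
        (√(1 + diagonal (fun i ↦ (k i : ℝ)) * D).det)⁻¹ := by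
      intro k
      have hdiag : 1 + diagonal (fun i ↦ (k i : ℝ)) * D =
          fromBlocks (1 + diagonal (fun i ↦ (k (.inl i) : ℝ)) * (V * Vᵀ)) 0 0
            (1 + diagonal (fun j ↦ (k (.inr j) : ℝ)) * (W * Wᵀ)) := by
        ext (i | i) (j | j) <;> simp [hD, diagonal_mul, Matrix.one_apply]
      have hpos := det_one_add_diagonal_mul_pos (fun i ↦ Nat.cast_nonneg (k (.inl i)))
        (by simpa using posSemidef_self_mul_conjTranspose V)
      simp only [w, Fintype.prod_sum_type, Sum.elim_inl, Sum.elim_inr]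
      rw [integral_prod_mul (fun x ↦ ∏ i, gaussianProfile V x i ^ k (.inl i))
        (fun x ↦ ∏ j, gaussianProfile W x j ^ k (.inr j)), hdiag, det_fromBlocks_zero₂₁,
        Real.sqrt_mul hpos.le, mul_inv]
      exact congr_arg₂ _ (integral_prod_exp_pow_stdGaussian V _)
        (integral_prod_exp_pow_stdGaussian W _)
    rw [gaussianPolyExpectation, sum_coeff_mul_moment_eq_integral _ hw hw01 hmom _ _
      fun _ ↦ Nat.lt_succ_self _]
    simp [w, Fintype.prod_sum_type]
  rw [hleft, hright]
  refine gaussianPolyExpectation_le (s := Sum.elim (fun _ ↦ 1) (fun _ ↦ -1)) ?_ ?_ ?_ ?_ _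
    (fun _ ↦ hp) (fun _ ↦ hp')
  · rintro (i | j) <;> simp
  · ext (i | i) (j | j) <;> simp [hD]
  · ext (i | i) (j | j) <;> simp [hN]
  · rw [hDN]
    simpa using posSemidef_self_mul_conjTranspose (fromRows V W)

lemma tendsto_integral_of_tendsto_indicator {Ω : Type*} [TopologicalSpace Ω] [MeasurableSpace Ω]
    [OpensMeasurableSpace Ω]
    (μ : Measure Ω) [IsProbabilityMeasure μ] {f : ℕ → Ω → ℝ} {A : Set Ω} (hA : MeasurableSet A)
    (hf : ∀ n, Continuous (f n)) (hf01 : ∀ n x, f n x ∈ Set.Icc (0 : ℝ) 1)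
    (hlim : ∀ x, Tendsto (fun n ↦ f n x) atTop (𝓝 (A.indicator 1 x))) :
    Tendsto (fun n ↦ ∫ x, f n x ∂μ) atTop (𝓝 (μ.real A)) := by
  rw [← integral_indicator_one hA]
  refine tendsto_integral_of_dominated_convergence (fun _ ↦ 1)
    (fun n ↦ (hf n).aestronglyMeasurable) (integrable_const 1) (fun n ↦ .of_forall fun x ↦ ?_)
    (.of_forall hlim)
  rw [Real.norm_of_nonneg (hf01 n x).1]
  exact (hf01 n x).2

/-- The Gaussian correlation inequality for two finite intersections of symmetric strips. -/
lemma stdGaussian_stripInter_mul_le (V : Matrix ι m ℝ) (W : Matrix κ m ℝ) :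
    stdGaussian (EuclideanSpace ℝ m) (stripInter V) *
        stdGaussian (EuclideanSpace ℝ m) (stripInter W) ≤
      stdGaussian (EuclideanSpace ℝ m) (stripInter V ∩ stripInter W) := by
  have hV := (isClosed_stripInter V).measurableSet
  have hW := (isClosed_stripInter W).measurableSet
  have h : (stdGaussian (EuclideanSpace ℝ m)).real (stripInter V) *
      (stdGaussian (EuclideanSpace ℝ m)).real (stripInter W) ≤
      (stdGaussian (EuclideanSpace ℝ m)).real (stripInter V ∩ stripInter W) := by
    refine le_of_tendsto_of_tendsto'
      ((tendsto_integral_of_tendsto_indicator _ hV (continuous_prod_stepPoly V)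
        (fun n x ↦ prod_stepPoly_mem_Icc V x n) (tendsto_prod_stepPoly V)).mul
      (tendsto_integral_of_tendsto_indicator _ hW (continuous_prod_stepPoly W)
        (fun n x ↦ prod_stepPoly_mem_Icc W x n) (tendsto_prod_stepPoly W)))
      (tendsto_integral_of_tendsto_indicator (f := fun n x ↦
        (∏ i, (stepPoly n).eval (gaussianProfile V x i)) *
          ∏ j, (stepPoly n).eval (gaussianProfile W x j)) _ (hV.inter hW)
        (fun n ↦ (continuous_prod_stepPoly V n).mul (continuous_prod_stepPoly W n))
        (fun n x ↦ ?_) fun x ↦ ?_)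
      fun n ↦ integral_prod_eval_mul_le V W (stepPoly n)
        (fun u hu ↦ (stepPoly_eval_mem_Icc n hu).1)
        fun u hu ↦ stepPoly_derivative_eval_nonneg n hu
    · have h1 := prod_stepPoly_mem_Icc V x n
      have h2 := prod_stepPoly_mem_Icc W x n
      exact ⟨mul_nonneg h1.1 h2.1, mul_le_one₀ h1.2 h2.1 h2.2⟩
    · rw [Set.inter_indicator_one]
      exact (tendsto_prod_stepPoly V x).mul (tendsto_prod_stepPoly W x)
  rw [← ENNReal.toReal_le_toReal (ENNReal.mul_ne_top (measure_ne_top _ _) (measure_ne_top _ _))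
    (measure_ne_top _ _), ENNReal.toReal_mul]
  exact h

/-- The Gaussian correlation inequality for two countable intersections of symmetric strips. -/
lemma stdGaussian_stripInter_nat_mul_le (V W : Matrix ℕ m ℝ) :
    stdGaussian (EuclideanSpace ℝ m) (stripInter V) *
        stdGaussian (EuclideanSpace ℝ m) (stripInter W) ≤
      stdGaussian (EuclideanSpace ℝ m) (stripInter V ∩ stripInter W) := by
  let T : Matrix ℕ m ℝ → ℕ → Set (EuclideanSpace ℝ m) := fun V n ↦
    stripInter (V.submatrix (fun i : Fin n ↦ (i : ℕ)) id)
  have hmem : ∀ V n x, x ∈ T V n ↔ ∀ i < n, |(V *ᵥ WithLp.ofLp x) i| ≤ 1 := by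
    intro V n x
    exact ⟨fun h i hi ↦ h ⟨i, hi⟩, fun h i ↦ h i i.2⟩
  have hT : ∀ V, stripInter V = ⋂ n, T V n := by
    intro V
    ext x
    simp only [Set.mem_iInter, hmem]
    exact ⟨fun h n i _ ↦ h i, fun h i ↦ h (i + 1) i i.lt_succ_self⟩
  have hanti : ∀ V, Antitone (T V) := by
    intro V a b hab x hx
    rw [hmem] at hx ⊢
    exact fun i hi ↦ hx i (hi.trans_le hab)
  have hmeas : ∀ V n, MeasurableSet (T V n) := fun V n ↦ (isClosed_stripInter _).measurableSet
  have hlim : ∀ V, Tendsto (fun n ↦ stdGaussian (EuclideanSpace ℝ m) (T V n)) atTop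
      (𝓝 (stdGaussian (EuclideanSpace ℝ m) (stripInter V))) := by
    intro V
    rw [hT]
    exact tendsto_measure_iInter_atTop (fun n ↦ (hmeas V n).nullMeasurableSet) (hanti V)
      ⟨0, measure_ne_top _ _⟩
  have hlim2 : Tendsto (fun n ↦ stdGaussian (EuclideanSpace ℝ m) (T V n ∩ T W n)) atTop
      (𝓝 (stdGaussian (EuclideanSpace ℝ m) (stripInter V ∩ stripInter W))) := by
    rw [hT, hT, ← Set.iInter_inter_distrib]
    exact tendsto_measure_iInter_atTop
      (fun n ↦ ((hmeas V n).inter (hmeas W n)).nullMeasurableSet)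
      (fun a b hab ↦ Set.inter_subset_inter (hanti V hab) (hanti W hab)) ⟨0, measure_ne_top _ _⟩
  exact le_of_tendsto_of_tendsto'
    (ENNReal.Tendsto.mul (hlim V) (.inr (measure_ne_top _ _)) (hlim W) (.inr (measure_ne_top _ _)))
    hlim2 fun n ↦ stdGaussian_stripInter_mul_le _ _

end Strips

/-! ### Ellipsoids -/

/-- A centered ellipsoid is a countable intersection of symmetric strips: the unit ball is cut out
by the strips orthogonal to the members of a dense sequence in it. -/
lemma IsCenteredEllipsoid.exists_eq_stripInter {n : ℕ} {A : Set (EuclideanSpace ℝ (Fin n))}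
    (hA : IsCenteredEllipsoid A) : ∃ V : Matrix ℕ (Fin n) ℝ, A = stripInter V := by
  obtain ⟨U, r, hr, rfl⟩ := hA
  -- The ellipsoid is the preimage of the unit ball under `L`.
  let L : EuclideanSpace ℝ (Fin n) →ₗ[ℝ] EuclideanSpace ℝ (Fin n) :=
    (toEuclideanLin (diagonal fun i ↦ (r i)⁻¹)) ∘ₗ U.symm.toLinearEquiv.toLinearMap
  have hmem : ∀ x, x ∈ U '' standardEllipsoid r ↔ ‖L x‖ ≤ 1 := by
    intro x
    have h1 : ‖L x‖ ^ 2 = ∑ i, (U.symm x) i ^ 2 / r i ^ 2 := by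
      rw [EuclideanSpace.real_norm_sq_eq]
      refine Finset.sum_congr rfl fun i _ ↦ ?_
      have : L x i = (r i)⁻¹ * (U.symm x) i := by
        simp [L, toLpLin_apply, mulVec_diagonal]
      rw [this]; ring
    rw [← sq_le_one_iff₀ (norm_nonneg _), h1]
    constructor
    · rintro ⟨y, hy, rfl⟩
      simpa [standardEllipsoid] using hy
    · intro h
      exact ⟨U.symm x, h, by simp⟩
  let S : Set (EuclideanSpace ℝ (Fin n)) := Metric.closedBall 0 1
  have : Nonempty S := ⟨⟨0, by simp [S]⟩⟩
  let d : ℕ → S := TopologicalSpace.denseSeq S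
  have hball : ∀ z : EuclideanSpace ℝ (Fin n),
      ‖z‖ ≤ 1 ↔ ∀ j, |inner ℝ (d j : EuclideanSpace ℝ (Fin n)) z| ≤ 1 := by
    intro z
    constructor
    · intro hz j
      have hj : ‖(d j : EuclideanSpace ℝ (Fin n))‖ ≤ 1 := mem_closedBall_zero_iff.1 (d j).2
      exact (abs_real_inner_le_norm _ _).trans (mul_le_one₀ hj (norm_nonneg _) hz)
    · intro h
      have hclosed : IsClosed {w : S | |inner ℝ (w : EuclideanSpace ℝ (Fin n)) z| ≤ 1} :=
        isClosed_le (by fun_prop) continuous_const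
      have hall : ∀ w : S, |inner ℝ (w : EuclideanSpace ℝ (Fin n)) z| ≤ 1 := by
        intro w
        refine hclosed.closure_subset_iff.2 ?_ (TopologicalSpace.denseRange_denseSeq S w)
        rintro _ ⟨j, rfl⟩
        exact h j
      by_contra! hz
      have hz0 : 0 < ‖z‖ := by linarith
      have := hall ⟨‖z‖⁻¹ • z, by simp [S, norm_smul, hz0.ne']⟩
      rw [real_inner_smul_left, real_inner_self_eq_norm_sq, sq, inv_mul_cancel_left₀ hz0.ne',
        abs_of_pos hz0] at this
      linarith
  refine ⟨of fun j ↦ WithLp.ofLp (L.adjoint (d j)), ?_⟩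
  ext x
  rw [hmem, hball]
  refine forall_congr' fun j ↦ ?_
  have h1 := L.adjoint_inner_left x (d j : EuclideanSpace ℝ (Fin n))
  rw [← h1, real_inner_comm, EuclideanSpace.inner_eq_star_dotProduct, star_trivial]
  rfl

theorem theorem9 (n : ℕ) (A B : Set (EuclideanSpace ℝ (Fin n)))
    (hA : IsCenteredEllipsoid A) (hB : IsCenteredEllipsoid B) :
    ProbabilityTheory.stdGaussian (EuclideanSpace ℝ (Fin n)) A *
        ProbabilityTheory.stdGaussian (EuclideanSpace ℝ (Fin n)) B ≤
      ProbabilityTheory.stdGaussian (EuclideanSpace ℝ (Fin n)) (A ∩ B) := by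
  obtain ⟨V, rfl⟩ := hA.exists_eq_stripInter
  obtain ⟨W, rfl⟩ := hB.exists_eq_stripInter
  exact stdGaussian_stripInter_nat_mul_le V W
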